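/- Let $N\ge 3$ and let $\mathcal H\subset\mathbb R^N$ be a bounded open set with smooth boundary and $0\in\mathcal H$ ($\mathcal H$ need not be connected); put $\Omega=\mathbb R^N\setminus\mathcal H$. Let $J:\mathbb R^N\to[0,\infty)$ be $C^\infty$, radially symmetric, supported in the unit ball, with $J(0)>0$ and $\int_{\mathbb R^N}J=1$. Let $\phi$ be the solution of $$J*\phi=\phi\ \text{ in }\Omega,\qquad \phi=0\ \text{ in }\mathcal H,\qquad \phi(x)\to1\ \text{ as }|x|\to\infty,$$ and put $\psi=1-\phi$. Then $\psi$ is smooth in $\Omega$ (up to the boundary), and there is a constant $C$ such that $$|\Delta\psi(x)|\le\frac{C}{|x|^{N+2}}\qquad\text{for all }x\in\Omega ,$$ where at points of $\partial\Omega$ the derivatives are taken from within $\Omega$. In particular, $\Delta\psi$ is integrable over $\Omega$. -/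

import Mathlib

open MeasureTheory Filter Topology
open scoped ContDiff Convolution InnerProductSpace

/-- Conditions on the kernel `J` of the nonlocal diffusion: smooth, nonnegative, radially symmetric,
with support contained in the unit ball, unit integral and `J 0 > 0`. -/
structure IsDiffusionKernel {N : ℕ} (J : EuclideanSpace ℝ (Fin N) → ℝ) : Prop where
  smooth : ContDiff ℝ ∞ J
  nonneg : ∀ x, 0 ≤ J x
  radial : ∀ x y, ‖x‖ = ‖y‖ → J x = J y
  support_subset : tsupport J ⊆ Metric.closedBall 0 1
  integral_eq_one : ∫ x, J x = 1
  pos_zero : 0 < J 0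

/-- The set `H` has smooth boundary: near each of its boundary points, `H` is the strict sublevel
set of a smooth function whose differential does not vanish at that point. -/
def HasSmoothBoundary {N : ℕ} (H : Set (EuclideanSpace ℝ (Fin N))) : Prop :=
  ∀ p ∈ frontier H, ∃ (U : Set (EuclideanSpace ℝ (Fin N))) (ρ : EuclideanSpace ℝ (Fin N) → ℝ),
    IsOpen U ∧ p ∈ U ∧ ContDiffOn ℝ ∞ ρ U ∧ fderiv ℝ ρ p ≠ 0 ∧ H ∩ U = {x ∈ U | ρ x < 0}

/-- `φ` solves the stationary problem in the exterior domain `Hᶜ`: `J * φ = φ` in `Hᶜ`, `φ = 0`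
in `H`, and `φ(x) → 1` as `|x| → ∞`. Local integrability makes the convolution meaningful. -/
structure IsStationarySolution {N : ℕ} (J : EuclideanSpace ℝ (Fin N) → ℝ)
    (H : Set (EuclideanSpace ℝ (Fin N))) (φ : EuclideanSpace ℝ (Fin N) → ℝ) : Prop where
  locallyIntegrable : LocallyIntegrable φ volume
  conv_eq : ∀ x ∈ Hᶜ, (J ⋆[ContinuousLinearMap.mul ℝ ℝ, volume] φ) x = φ x
  eq_zero : ∀ x ∈ H, φ x = 0
  tendsto_one : Tendsto φ (cocompact (EuclideanSpace ℝ (Fin N))) (𝓝 1)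

/-! The convolution `u = J * ψ` is smooth on the whole space and equals `ψ` outside `H`, so it
suffices to bound `Δ u`. The symbol of `J` satisfies `1 - Ĵ(ξ) = ‖ξ‖² P(‖ξ‖²)` with `P` smooth and
positive (`exists_one_sub_cosTransform_eq`). Hence the singularity of the Green symbol `Ĵ / (1 - Ĵ)`
at the origin is cancelled by the symbol `-(2π)²‖ξ‖²` of the Laplacian, and the quotient is the
transform of a Schwartz function `K` with `K - J * K = Δ J` (`exists_schwartz_kernel`).

Convolving with `ψ` gives `Δ u = K * ψ - K * (J * ψ) = K * (ψ - u)`. Since `ψ - u` is bounded and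
vanishes off the bounded set `H`, `Δ u` decays faster than every power
(`IsStationarySolution.exists_norm_pow_mul_laplacian_le`), which is more than the stated rate. -/

/-! ### Fourier transform of a radial kernel. -/

section CosineTransform

open Real FourierTransform

variable {E : Type*} [NormedAddCommGroup E] [InnerProductSpace ℝ E] [FiniteDimensional ℝ E]
  [MeasurableSpace E] [BorelSpace E]

/-- The cosine transform of a real function, which is its Fourier transform if it is even. -/
noncomputable def cosTransform (J : E → ℝ) (ξ : E) : ℝ :=
  ∫ x, cos (2 * π * ⟪x, ξ⟫_ℝ) * J x

lemma integrable_cos_mul {J : E → ℝ} (hJ : Integrable J) (ξ : E) :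
    Integrable fun x => cos (2 * π * ⟪x, ξ⟫_ℝ) * J x :=
  hJ.bdd_mul (c := 1) (by fun_prop) (.of_forall fun x => by simpa using abs_cos_le_one _)

lemma integrable_sin_mul {J : E → ℝ} (hJ : Integrable J) (ξ : E) :
    Integrable fun x => sin (2 * π * ⟪x, ξ⟫_ℝ) * J x :=
  hJ.bdd_mul (c := 1) (by fun_prop) (.of_forall fun x => by simpa using abs_sin_le_one _)

lemma fourier_ofReal_eq_cosTransform {J : E → ℝ} (hJ : Integrable J)
    (heven : ∀ x, J (-x) = J x) (ξ : E) :
    𝓕 (fun x => (J x : ℂ)) ξ = (cosTransform J ξ : ℂ) := by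
  have hsin : ∫ x, sin (2 * π * ⟪x, ξ⟫_ℝ) * J x = 0 := by
    have h := integral_neg_eq_self (fun x => sin (2 * π * ⟪x, ξ⟫_ℝ) * J x) volume
    simp only [inner_neg_left, mul_neg, sin_neg, heven, neg_mul, integral_neg] at h
    linarith
  have hI (x : E) : Complex.exp (↑(-2 * π * ⟪x, ξ⟫_ℝ) * Complex.I) • (J x : ℂ) =
      ((cos (2 * π * ⟪x, ξ⟫_ℝ) * J x : ℝ) : ℂ) -
        Complex.I * ((sin (2 * π * ⟪x, ξ⟫_ℝ) * J x : ℝ) : ℂ) := by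
    rw [Complex.exp_mul_I, ← Complex.ofReal_cos, ← Complex.ofReal_sin,
      show -2 * π * ⟪x, ξ⟫_ℝ = -(2 * π * ⟪x, ξ⟫_ℝ) by ring, cos_neg, sin_neg]
    push_cast
    rw [smul_eq_mul]
    ring
  rw [Real.fourier_eq', integral_congr_ae (.of_forall hI), integral_sub
    (integrable_cos_mul hJ ξ).ofReal ((integrable_sin_mul hJ ξ).ofReal.const_mul _),
    integral_const_mul]
  have h2 := integral_ofReal (𝕜 := ℂ) (μ := volume) (f := fun x => sin (2 * π * ⟪x, ξ⟫_ℝ) * J x)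
  have h1 := integral_ofReal (𝕜 := ℂ) (μ := volume) (f := fun x => cos (2 * π * ⟪x, ξ⟫_ℝ) * J x)
  simp only [Complex.coe_algebraMap] at h1 h2
  erw [h1, h2, hsin]
  simp [cosTransform]

/-- The reflection exchanging `ξ` and `η` preserves both the measure and `J`. -/
lemma cosTransform_eq_of_norm_eq {J : E → ℝ} (hJ : ∀ x y, ‖x‖ = ‖y‖ → J x = J y) {ξ η : E}
    (h : ‖ξ‖ = ‖η‖) : cosTransform J ξ = cosTransform J η := by
  let A : E ≃ₗᵢ[ℝ] E := (ℝ ∙ (ξ - η))ᗮ.reflection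
  have hA : A ξ = η := Submodule.reflection_sub h
  rw [cosTransform, cosTransform, ← (A.measurePreserving).integral_comp'
    (f := A.toMeasurableEquiv) (fun x => cos (2 * π * ⟪x, η⟫_ℝ) * J x)]
  refine integral_congr_ae (.of_forall fun x => ?_)
  have h1 : ⟪A x, η⟫_ℝ = ⟪x, ξ⟫_ℝ := by rw [← hA, A.inner_map_map]
  have h2 : J (A x) = J x := hJ _ _ (A.norm_map x)
  simp [h1, h2]

lemma cosTransform_lt_integral {J : E → ℝ} (hc : Continuous J) (hs : HasCompactSupport J)
    (h0 : ∀ x, 0 ≤ J x) (hpos : 0 < J 0) {ξ : E} (hξ : ξ ≠ 0) :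
    cosTransform J ξ < ∫ x, J x := by
  have hint := hc.integrable_of_hasCompactSupport hs (μ := volume)
  have hsub : (∫ x, J x) - cosTransform J ξ = ∫ x, (1 - cos (2 * π * ⟪x, ξ⟫_ℝ)) * J x := by
    rw [cosTransform, ← integral_sub hint (integrable_cos_mul hint ξ)]
    exact integral_congr_ae (.of_forall fun x => by ring)
  rw [← sub_pos, hsub]
  have hξ' : 0 < ‖ξ‖ := norm_pos_iff.2 hξ
  have hJ : ∀ᶠ t : ℝ in 𝓝[>] 0, 0 < J (t • ξ) := by
    have : Tendsto (fun t : ℝ => J (t • ξ)) (𝓝 0) (𝓝 (J 0)) := by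
      have : Continuous fun t : ℝ => J (t • ξ) := by fun_prop
      simpa using this.tendsto 0
    exact (this.eventually (lt_mem_nhds hpos)).filter_mono nhdsWithin_le_nhds
  -- At the point `t • ξ` this puts the phase `2πt‖ξ‖²` strictly between `0` and `π`, so the cosine
  -- is below `1`.
  have hsmall : ∀ᶠ t : ℝ in 𝓝[>] 0, t < 1 / (2 * ‖ξ‖ ^ 2) :=
    (eventually_lt_nhds (by positivity)).filter_mono nhdsWithin_le_nhds
  obtain ⟨t, ht, ht', ht0⟩ := (hJ.and (hsmall.and self_mem_nhdsWithin)).exists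
  have ht0 : 0 < t := ht0
  refine Continuous.integral_pos_of_hasCompactSupport_nonneg_nonzero (x := t • ξ) (by fun_prop)
    hs.mul_left (fun x => mul_nonneg (by linarith [cos_le_one (2 * π * ⟪x, ξ⟫_ℝ)]) (h0 x)) ?_
  refine mul_ne_zero ?_ ht.ne'
  have hlt : t * ‖ξ‖ ^ 2 < 1 / 2 := by
    rw [lt_div_iff₀ (by positivity)] at ht'
    linarith
  have hp : 0 < t * ‖ξ‖ ^ 2 := by positivity
  have : cos (2 * π * ⟪t • ξ, ξ⟫_ℝ) < 1 := by
    rw [real_inner_smul_left, real_inner_self_eq_norm_sq, ← cos_zero]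
    refine cos_lt_cos_of_nonneg_of_le_pi le_rfl ?_ (by positivity)
    nlinarith [pi_pos]
  linarith

end CosineTransform

/-! ### Entire power series. -/

section EntireSeries

/-- A real power series with infinite radius of convergence is smooth. -/
lemma contDiff_tsum_mul_pow {c : ℕ → ℝ} (hc : ∀ r : NNReal, Summable fun n => |c n| * (r : ℝ) ^ n) :
    ContDiff ℝ ∞ fun s : ℝ => ∑' n, c n * s ^ n := by
  have hr : (FormalMultilinearSeries.ofScalars ℝ c).radius = ⊤ := by
    refine FormalMultilinearSeries.radius_eq_top_of_summable_norm _ fun r => ?_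
    simpa [FormalMultilinearSeries.ofScalars_norm] using hc r
  have h := (FormalMultilinearSeries.ofScalars ℝ c).hasFPowerSeriesOnBall (by simp [hr])
  have h2 := h.analyticOnNhd
  rw [hr, Metric.eball_top] at h2
  convert! h2.contDiff (n := ∞) using 1
  funext s
  exact (FormalMultilinearSeries.ofScalars_sum_eq c s).symm

end EntireSeries

/-! ### Vanishing order of `1 - Ĵ` at the origin. -/

section Symbol

open Real

variable {E : Type*} [NormedAddCommGroup E] [InnerProductSpace ℝ E] [FiniteDimensional ℝ E]
  [MeasurableSpace E] [BorelSpace E]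

/-- The cosine transform along a unit direction as a power series in even moments. -/
lemma hasSum_cosTransform_smul {J : E → ℝ} (hJ : Integrable J)
    (hs : ∀ x, J x ≠ 0 → ‖x‖ ≤ 1) {e : E} (he : ‖e‖ = 1) (r : ℝ) :
    HasSum (fun k : ℕ => (-1) ^ k * (2 * π * r) ^ (2 * k) / (2 * k).factorial *
      ∫ x, ⟪x, e⟫_ℝ ^ (2 * k) * J x) (cosTransform J (r • e)) := by
  set F : ℕ → E → ℝ := fun k x =>
    (-1) ^ k * (2 * π * ⟪x, r • e⟫_ℝ) ^ (2 * k) / (2 * k).factorial * J x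
  have hF (k : ℕ) (x : E) : F k x = (-1) ^ k * (2 * π * r) ^ (2 * k) / (2 * k).factorial *
      (⟪x, e⟫_ℝ ^ (2 * k) * J x) := by
    simp only [F, real_inner_smul_right]
    rw [show 2 * π * (r * ⟪x, e⟫_ℝ) = (2 * π * r) * ⟪x, e⟫_ℝ by ring, mul_pow]
    ring
  have hbd (k : ℕ) (x : E) : ‖⟪x, e⟫_ℝ ^ (2 * k) * J x‖ ≤ ‖J x‖ := by
    by_cases hx : J x = 0
    · simp [hx]
    · rw [norm_mul, norm_pow]
      refine mul_le_of_le_one_left (norm_nonneg _) (pow_le_one₀ (norm_nonneg _) ?_)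
      have := norm_inner_le_norm (𝕜 := ℝ) x e
      rw [he, mul_one] at this
      exact this.trans (hs x hx)
  have hmi (k : ℕ) : Integrable fun x => ⟪x, e⟫_ℝ ^ (2 * k) * J x :=
    hJ.mono ((by fun_prop : Continuous fun x : E => ⟪x, e⟫_ℝ ^ (2 * k)).aestronglyMeasurable.mul
      hJ.aestronglyMeasurable) (.of_forall (hbd k))
  have hFi (k : ℕ) : Integrable (F k) := by
    rw [funext (hF k)]
    exact (hmi k).const_mul _
  have hsum : Summable fun k => ∫ x, ‖F k x‖ := by
    have hexp : Summable fun k : ℕ => |2 * π * r| ^ (2 * k) / (2 * k).factorial * ∫ x, ‖J x‖ :=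
      ((Real.summable_pow_div_factorial |2 * π * r|).comp_injective
        (mul_right_injective₀ two_ne_zero)).mul_right _
    refine hexp.of_nonneg_of_le (fun k => by positivity) fun k => ?_
    rw [← integral_const_mul]
    refine integral_mono (hFi k).norm (hJ.norm.const_mul _) fun x => ?_
    simp only [hF]
    rw [norm_mul]
    refine mul_le_mul (le_of_eq ?_) (hbd k x) (norm_nonneg _) (by positivity)
    simp [abs_mul, mul_pow]
  have h := hasSum_integral_of_summable_integral_norm hFi hsum
  have hcos : ∀ x, ∑' k, F k x = cos (2 * π * ⟪x, r • e⟫_ℝ) * J x := fun x =>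
    ((Real.hasSum_cos _).mul_right (J x)).tsum_eq
  simp only [hcos] at h
  convert! h using 2 with k
  rw [← integral_const_mul]
  exact integral_congr_ae (.of_forall fun x => (hF k x).symm)

/-- For a radial probability density, `1 - cosTransform J ξ` is a smooth function of `‖ξ‖ ^ 2`
vanishing exactly to first order. -/
lemma exists_one_sub_cosTransform_eq [Nontrivial E] {J : E → ℝ} (hc : Continuous J)
    (h0 : ∀ x, 0 ≤ J x) (hpos : 0 < J 0) (hrad : ∀ x y, ‖x‖ = ‖y‖ → J x = J y)
    (hs : tsupport J ⊆ Metric.closedBall 0 1) (h1 : ∫ x, J x = 1) :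
    ∃ P : ℝ → ℝ, ContDiff ℝ ∞ P ∧ (∀ s, 0 ≤ s → 0 < P s) ∧
      ∀ ξ : E, 1 - cosTransform J ξ = ‖ξ‖ ^ 2 * P (‖ξ‖ ^ 2) := by
  obtain ⟨e, he⟩ := exists_norm_eq E zero_le_one
  have hcs : HasCompactSupport J := .of_isClosed_subset (isCompact_closedBall 0 1)
    (isClosed_tsupport J) hs
  have hJ := hc.integrable_of_hasCompactSupport hcs (μ := volume)
  have hs' : ∀ x, J x ≠ 0 → ‖x‖ ≤ 1 := fun x hx => by
    simpa using hs (subset_tsupport J hx)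
  set m : ℕ → ℝ := fun k => ∫ x, ⟪x, e⟫_ℝ ^ (2 * k) * J x with hm
  have hm1 (k : ℕ) : |m k| ≤ 1 := by
    rw [← h1]
    refine norm_integral_le_of_norm_le (f := fun x => ⟪x, e⟫_ℝ ^ (2 * k) * J x) hJ
      (.of_forall fun x => ?_)
    by_cases hx : J x = 0
    · simp [hx]
    · rw [norm_mul, norm_pow, norm_of_nonneg (h0 x)]
      refine mul_le_of_le_one_left (h0 x) (pow_le_one₀ (norm_nonneg _) ?_)
      have := norm_inner_le_norm (𝕜 := ℝ) x e
      rw [he, mul_one] at this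
      exact this.trans (hs' x hx)
  -- Coefficients of `1 - Ĵ` in powers of `‖ξ‖²`, shifted by one: the constant terms cancel because
  -- `∫ J = 1`, and one factor `‖ξ‖²` is taken out.
  set c : ℕ → ℝ := fun k => -((-1) ^ (k + 1) * (2 * π) ^ (2 * (k + 1)) / (2 * (k + 1)).factorial *
    m (k + 1))
  have hcs' (s : NNReal) : Summable fun k => |c k| * (s : ℝ) ^ k := by
    -- The radius `√(s + 1)` absorbs the shift, through `s ^ k ≤ (s + 1) ^ (k + 1)`.
    have hexp := (((Real.summable_pow_div_factorial (2 * π * √(s + 1))).comp_injective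
        (mul_right_injective₀ two_ne_zero)).comp_injective (add_left_injective 1))
    refine hexp.of_nonneg_of_le (fun k => by positivity) fun k => ?_
    simp only [c, abs_neg, abs_mul, abs_div, abs_pow, abs_one, one_pow, one_mul, Nat.abs_cast,
      Function.comp_apply, abs_two, abs_of_pos pi_pos]
    have : √((s : ℝ) + 1) ^ (2 * (k + 1)) = (s + 1) ^ (k + 1) := by
      rw [pow_mul, sq_sqrt (by positivity)]
    rw [mul_pow _ √((s : ℝ) + 1), this, mul_div_right_comm]
    have h2 : (s : ℝ) ^ k ≤ (s + 1) ^ (k + 1) :=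
      (pow_le_pow_left₀ (by positivity) (by linarith) k).trans
        (pow_le_pow_right₀ (by linarith [s.coe_nonneg]) (by omega))
    have h3 := hm1 (k + 1)
    have h4 : |m (k + 1)| * (s : ℝ) ^ k ≤ (s + 1) ^ (k + 1) :=
      (mul_le_of_le_one_left (by positivity) h3).trans h2
    rw [mul_assoc]
    exact mul_le_mul_of_nonneg_left h4 (by positivity)
  set P : ℝ → ℝ := fun s => ∑' k, c k * s ^ k with hP
  have hmain (ξ : E) : 1 - cosTransform J ξ = ‖ξ‖ ^ 2 * P (‖ξ‖ ^ 2) := by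
    have hr : cosTransform J ξ = cosTransform J (‖ξ‖ • e) :=
      cosTransform_eq_of_norm_eq hrad (by simp [norm_smul, he])
    have hsum := hasSum_cosTransform_smul hJ hs' he ‖ξ‖
    rw [← hr, ← hasSum_nat_add_iff' 1] at hsum
    have h2 := hsum.neg
    simp only [Finset.sum_range_one, mul_zero, pow_zero, Nat.factorial_zero, Nat.cast_one, mul_one,
      div_one, one_mul, h1, neg_sub] at h2
    rw [← h2.tsum_eq, hP, ← tsum_mul_left]
    refine tsum_congr fun k => ?_
    simp only [c, hm, mul_pow]
    ring
  -- `P 0` is `2π²` times the second moment of `J` along `e`.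
  have hP0 : 0 < P 0 := by
    have : P 0 = 2 * π ^ 2 * m 1 := by
      rw [hP]
      simp only
      rw [tsum_eq_single 0 (fun k hk => by simp [hk])]
      simp only [c]
      norm_num
      ring
    rw [this]
    refine mul_pos (by positivity) ?_
    have hJ' : ∀ᶠ t : ℝ in 𝓝[>] 0, 0 < J (t • e) := by
      have : Tendsto (fun t : ℝ => J (t • e)) (𝓝 0) (𝓝 (J 0)) := by
        have : Continuous fun t : ℝ => J (t • e) := by fun_prop
        simpa using this.tendsto 0
      exact (this.eventually (lt_mem_nhds hpos)).filter_mono nhdsWithin_le_nhds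
    obtain ⟨t, ht, ht0⟩ := (hJ'.and self_mem_nhdsWithin).exists
    have ht0 : 0 < t := ht0
    refine Continuous.integral_pos_of_hasCompactSupport_nonneg_nonzero (x := t • e) (by fun_prop)
      hcs.mul_left (fun x => mul_nonneg (Even.pow_nonneg (by simp) _) (h0 x)) ?_
    refine mul_ne_zero ?_ ht.ne'
    simp [real_inner_smul_left, he, ht0.ne']
  refine ⟨P, contDiff_tsum_mul_pow hcs', fun s hs0 => ?_, hmain⟩
  rcases hs0.eq_or_lt with rfl | hs0
  · exact hP0
  · have hne : √s • e ≠ 0 := smul_ne_zero (by positivity) (by rw [← norm_ne_zero_iff, he]; simp)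
    have h3 := hmain (√s • e)
    have h4 := cosTransform_lt_integral hc hcs h0 hpos hne
    rw [norm_smul, he, mul_one, norm_of_nonneg (by positivity), sq_sqrt hs0.le] at h3
    rw [h1] at h4
    exact pos_of_mul_pos_right (by linarith) hs0.le

end Symbol

/-! ### Inverses of functions of temperate growth. -/

section TemperateGrowth

variable {E : Type*} [NormedAddCommGroup E] [NormedSpace ℝ E]

lemma Function.HasTemperateGrowth.inv_of_mem_Icc {D : E → ℝ} (hD : D.HasTemperateGrowth) {c C : ℝ}
    (hc : 0 < c) (h : ∀ x, D x ∈ Set.Icc c C) : (fun x => (D x)⁻¹).HasTemperateGrowth := by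
  have hcC : c ≤ C := (h 0).1.trans (h 0).2
  -- Enlarging to `C + 1` keeps the interval nondegenerate when `c = C`.
  have hu : UniqueDiffOn ℝ (Set.Icc c (C + 1)) := uniqueDiffOn_Icc (by linarith)
  have hinv : ContDiffOn ℝ ∞ (fun t : ℝ => t⁻¹) (Set.Icc c (C + 1)) :=
    contDiffOn_id.inv fun t ht => (hc.trans_le ht.1).ne'
  refine Function.HasTemperateGrowth.comp' (g := fun t : ℝ => t⁻¹) (t := Set.Icc c (C + 1)) ?_ hu
    hinv (fun n => ?_) hD
  · rintro _ ⟨x, rfl⟩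
    exact ⟨(h x).1, by linarith [(h x).2]⟩
  · have hb : ∀ i : ℕ, ∃ B, ∀ t ∈ Set.Icc c (C + 1),
        ‖iteratedFDerivWithin ℝ i (fun t : ℝ => t⁻¹) (Set.Icc c (C + 1)) t‖ ≤ B := fun i =>
      isCompact_Icc.exists_bound_of_continuousOn
        (hinv.continuousOn_iteratedFDerivWithin (mod_cast le_top) hu)
    choose B hB using hb
    refine ⟨0, ∑ i ∈ Finset.range (n + 1), |B i|, by positivity, fun i hi t ht => ?_⟩
    rw [pow_zero, mul_one]
    exact (hB i t ht).trans ((le_abs_self _).trans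
      (Finset.single_le_sum (f := fun i => |B i|) (fun _ _ => abs_nonneg _) (by simp; omega)))

lemma exists_mem_Icc_of_tendsto_cocompact {X : Type*} [TopologicalSpace X] {D : X → ℝ}
    (hD : Continuous D) (hpos : ∀ x, 0 < D x) {l : ℝ} (hl : 0 < l)
    (hlim : Tendsto D (cocompact X) (𝓝 l)) : ∃ c C, 0 < c ∧ ∀ x, D x ∈ Set.Icc c C := by
  have hev : ∀ᶠ x in cocompact X, D x ∈ Set.Ioo (l / 2) (l + 1) :=
    hlim.eventually (Ioo_mem_nhds (by linarith) (by linarith))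
  obtain ⟨K, hK, hKs⟩ := mem_cocompact.1 hev
  rcases K.eq_empty_or_nonempty with rfl | hne
  · refine ⟨l / 2, l + 1, by positivity, fun x => ?_⟩
    have := @hKs x (by simp)
    exact ⟨this.1.le, this.2.le⟩
  obtain ⟨a, -, ha⟩ := hK.exists_isMinOn hne hD.continuousOn
  obtain ⟨b, -, hb⟩ := hK.exists_isMaxOn hne hD.continuousOn
  refine ⟨min (D a) (l / 2), max (D b) (l + 1), lt_min (hpos a) (by positivity), fun x => ?_⟩
  by_cases hx : x ∈ K
  · exact ⟨(min_le_left _ _).trans (ha hx), (hb hx).trans (le_max_left _ _)⟩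
  · exact ⟨(min_le_right _ _).trans (hKs hx).1.le, (hKs hx).2.le.trans (le_max_right _ _)⟩

end TemperateGrowth

/-! ### The Schwartz kernel `K`. -/

section Kernel

open Real FourierTransform SchwartzMap Laplacian

variable {E : Type*} [NormedAddCommGroup E] [InnerProductSpace ℝ E] [FiniteDimensional ℝ E]

/-- Division of the real Fourier symbol `j` by `(1 - j) / ‖·‖ ^ 2` in the Schwartz space. -/
lemma exists_schwartz_div (j : 𝓢(E, ℝ)) {P : ℝ → ℝ} (hP : ContDiff ℝ ∞ P)
    (hPpos : ∀ s, 0 ≤ s → 0 < P s) (hj : ∀ ξ : E, 1 - j ξ = ‖ξ‖ ^ 2 * P (‖ξ‖ ^ 2)) :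
    ∃ M : 𝓢(E, ℝ), ∀ ξ, (1 - j ξ) * M ξ = ‖ξ‖ ^ 2 * j ξ := by
  let χ : ContDiffBump (0 : E) := ⟨1, 2, one_pos, one_lt_two⟩
  have hQ : ContDiff ℝ ∞ fun ξ : E => χ ξ * P (‖ξ‖ ^ 2) :=
    χ.contDiff.mul (hP.comp (contDiff_norm_sq ℝ))
  have hQs : HasCompactSupport fun ξ : E => χ ξ * P (‖ξ‖ ^ 2) := χ.hasCompactSupport.mul_right
  -- The bump removes the zero of `1 - j` at the origin: `D = (‖ξ‖² + χ) P` is positive and tends to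
  -- `1`, so its inverse has temperate growth. The witness `(‖ξ‖² + χ) D⁻¹ j` below is then `j / P`.
  set D : E → ℝ := fun ξ => 1 - j ξ + χ ξ * P (‖ξ‖ ^ 2) with hD
  have hDt : D.HasTemperateGrowth :=
    ((Function.HasTemperateGrowth.const 1).sub j.hasTemperateGrowth).add (hQs.hasTemperateGrowth hQ)
  have hDeq (ξ : E) : D ξ = (‖ξ‖ ^ 2 + χ ξ) * P (‖ξ‖ ^ 2) := by
    rw [hD]; simp only [hj]; ring
  have hpos (ξ : E) : 0 < ‖ξ‖ ^ 2 + χ ξ := by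
    rcases eq_or_ne ξ 0 with rfl | hξ
    · have : χ (0 : E) = 1 := χ.one_of_mem_closedBall (by simp [χ.rIn_pos.le])
      simp [this]
    · have := χ.nonneg (x := ξ)
      positivity
  have hDpos (ξ : E) : 0 < D ξ := by
    rw [hDeq]; exact mul_pos (hpos ξ) (hPpos _ (by positivity))
  have hlim : Tendsto D (cocompact E) (𝓝 1) := by
    have h1 := (tendsto_const_nhds (x := (1 : ℝ))).sub j.tendsto_cocompact
    have h2 := h1.add (hQs.toSchwartzMap hQ).tendsto_cocompact
    simpa using h2
  obtain ⟨c, C, hc, hcC⟩ := exists_mem_Icc_of_tendsto_cocompact hDt.1.continuous hDpos one_pos hlim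
  have hχ : (fun ξ : E => χ ξ).HasTemperateGrowth :=
    χ.hasCompactSupport.hasTemperateGrowth χ.contDiff
  have hg : (fun ξ : E => (‖ξ‖ ^ 2 + χ ξ) * (D ξ)⁻¹).HasTemperateGrowth :=
    ((by fun_prop : (fun ξ : E => ‖ξ‖ ^ 2).HasTemperateGrowth).add hχ).mul (hDt.inv_of_mem_Icc hc hcC)
  refine ⟨smulLeftCLM ℝ (fun ξ : E => (‖ξ‖ ^ 2 + χ ξ) * (D ξ)⁻¹) j, fun ξ => ?_⟩
  rw [smulLeftCLM_apply_apply hg, hDeq, hj]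
  have := hpos ξ
  have := hPpos (‖ξ‖ ^ 2) (by positivity)
  simp only [smul_eq_mul]
  field_simp

variable [MeasurableSpace E] [BorelSpace E]

/-- The Laplacian of the Green function: a rapidly decreasing `K` with `K - J * K = Δ J`. -/
lemma exists_schwartz_kernel [Nontrivial E] {J : E → ℝ} (hJ : ContDiff ℝ ∞ J)
    (h0 : ∀ x, 0 ≤ J x) (hpos : 0 < J 0) (hrad : ∀ x y, ‖x‖ = ‖y‖ → J x = J y)
    (hs : tsupport J ⊆ Metric.closedBall 0 1) (h1 : ∫ x, J x = 1) :
    ∃ K : 𝓢(E, ℝ), ∀ x, K x - (J ⋆[ContinuousLinearMap.mul ℝ ℝ, volume] K) x = Δ J x := by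
  have hcs : HasCompactSupport J := .of_isClosed_subset (isCompact_closedBall 0 1)
    (isClosed_tsupport J) hs
  obtain ⟨P, hP, hPpos, hPeq⟩ := exists_one_sub_cosTransform_eq hJ.continuous h0 hpos hrad hs h1
  let Jr : 𝓢(E, ℝ) := hcs.toSchwartzMap hJ
  let Jc : 𝓢(E, ℂ) := postcompCLM (𝕜 := ℝ) Complex.ofRealCLM Jr
  let j : 𝓢(E, ℝ) := postcompCLM (𝕜 := ℝ) Complex.reCLM (𝓕 Jc)
  have hJc : (Jc : E → ℂ) = fun x => (J x : ℂ) := rfl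
  have hF (ξ : E) : 𝓕 Jc ξ = (cosTransform J ξ : ℂ) := by
    rw [fourier_coe, hJc, fourier_ofReal_eq_cosTransform
      (hJ.continuous.integrable_of_hasCompactSupport hcs) (fun x => hrad _ _ (norm_neg x))]
  have hjcos (ξ : E) : j ξ = cosTransform J ξ := by
    simp [j, postcompCLM_apply, hF]
  have hFj (ξ : E) : 𝓕 Jc ξ = (j ξ : ℂ) := by rw [hF, hjcos]
  obtain ⟨M, hM⟩ := exists_schwartz_div j hP hPpos fun ξ => by rw [hjcos, hPeq]
  let Mc : 𝓢(E, ℂ) := postcompCLM (𝕜 := ℝ) Complex.ofRealCLM M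
  let Kc : 𝓢(E, ℂ) := 𝓕⁻ ((-(2 * π) ^ 2 : ℝ) • Mc)
  have hKc : Kc - SchwartzMap.convolution (ContinuousLinearMap.mul ℂ ℂ) Jc Kc = Δ Jc := by
    have h : 𝓕 (Kc - SchwartzMap.convolution (ContinuousLinearMap.mul ℂ ℂ) Jc Kc) = 𝓕 (Δ Jc) := by
      rw [laplacian_eq_fourierMultiplierCLM, fourierMultiplierCLM_apply, sub_eq_add_neg,
        FourierTransform.fourier_add, FourierTransform.fourier_neg, fourier_convolution,
        FourierTransform.fourier_smul, FourierTransform.fourier_fourierInv_eq,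
        FourierTransform.fourier_fourierInv_eq]
      ext ξ
      have hg : (fun ξ : E => ‖ξ‖ ^ 2).HasTemperateGrowth := by fun_prop
      have h2 := smulLeftCLM_apply_apply (F := ℂ) hg (𝓕 Jc) ξ
      have h3 : Mc ξ = (M ξ : ℂ) := rfl
      change (-(2 * π) ^ 2 : ℝ) • Mc ξ + -((𝓕 Jc ξ) * ((-(2 * π) ^ 2 : ℝ) • Mc ξ)) =
        (-(2 * π) ^ 2 : ℝ) • smulLeftCLM ℂ (fun ξ : E => ‖ξ‖ ^ 2) (𝓕 Jc) ξ
      rw [h2, hFj, h3]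
      simp only [Complex.real_smul]
      have h4 := congrArg (fun t : ℝ => (t : ℂ)) (hM ξ)
      push_cast at h4 ⊢
      linear_combination (-(2 * (π : ℂ)) ^ 2) * h4
    have := congrArg (fun f : 𝓢(E, ℂ) => 𝓕⁻ f) h
    simpa using this
  -- As `J` is real, the real part of `Kc` solves the same equation.
  refine ⟨postcompCLM (𝕜 := ℝ) Complex.reCLM Kc, fun x => ?_⟩
  have hx := congrArg (fun f : 𝓢(E, ℂ) => (f x).re) hKc
  simp only [_root_.sub_apply, Complex.sub_re, convolution_apply, laplacian_apply] at hx
  have hlap : (Δ (Jc : E → ℂ) x) = (Δ J x : ℝ) := by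
    have hJ2 : ContDiff ℝ 2 J := contDiff_infty.1 hJ 2
    exact hJ2.contDiffAt.laplacian_CLM_comp_left (l := Complex.ofRealCLM)
  rw [hlap, Complex.ofReal_re] at hx
  rw [← hx]
  congr 1
  have hint : Integrable fun t => (Jc t) * (Kc (x - t)) :=
    (BddAbove.convolutionExistsAt (L := ContinuousLinearMap.mul ℂ ℂ) (x₀ := x) (s := Set.univ)
      (f := Jc) (g := Kc) (μ := volume) ⟨SchwartzMap.seminorm ℝ 0 0 Kc, by
        rintro _ ⟨y, -, rfl⟩; exact norm_le_seminorm ℝ Kc _⟩ .univ (by simp)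
        Jc.integrable.integrableOn Kc.continuous.aestronglyMeasurable :)
  have h5 := integral_re hint
  rw [convolution_def, convolution_def]
  simp only [ContinuousLinearMap.mul_apply']
  refine Eq.trans ?_ h5
  refine integral_congr_ae (.of_forall fun t => ?_)
  have : Jc t = (J t : ℂ) := rfl
  simp [this, postcompCLM_apply]

end Kernel

/-! ### Convolution identities and decay. -/

section Convolution

open SchwartzMap Laplacian ContinuousLinearMap

variable {E : Type*} [NormedAddCommGroup E] [InnerProductSpace ℝ E] [FiniteDimensional ℝ E]
  [MeasurableSpace E] [BorelSpace E]

lemma convolution_mul_comm (f g : E → ℝ) :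
    f ⋆[mul ℝ ℝ, volume] g = g ⋆[mul ℝ ℝ, volume] f := by
  rw [← MeasureTheory.convolution_flip]
  congr 1
  ext
  simp

lemma convolutionExists_mul_of_bounded {f g : E → ℝ} (hf : Integrable f)
    (hg : AEStronglyMeasurable g) {B : ℝ} (hB : ∀ x, |g x| ≤ B) (x : E) :
    ConvolutionExistsAt f g x (mul ℝ ℝ) volume := by
  refine BddAbove.convolutionExistsAt (s := Set.univ) (mul ℝ ℝ) ⟨B, ?_⟩ .univ (by simp)
    hf.integrableOn hg
  rintro _ ⟨y, -, rfl⟩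
  exact hB y

lemma fderiv_convolution_mul_apply {f J : E → ℝ} (hf : LocallyIntegrable f)
    (hJs : HasCompactSupport J) (hJ : ContDiff ℝ 1 J) (x v : E) :
    fderiv ℝ (f ⋆[mul ℝ ℝ, volume] J) x v =
      (f ⋆[mul ℝ ℝ, volume] fun a => fderiv ℝ J a v) x := by
  rw [(hJs.hasFDerivAt_convolution_right (mul ℝ ℝ) hf hJ x).fderiv]
  exact convolution_precompR_apply _ hf (hJs.fderiv ℝ) (hJ.continuous_fderiv one_ne_zero) x v

lemma laplacian_convolution_mul {f J : E → ℝ} (hf : LocallyIntegrable f)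
    (hJs : HasCompactSupport J) (hJ : ContDiff ℝ ∞ J) (x : E) :
    Δ (f ⋆[mul ℝ ℝ, volume] J) x = (f ⋆[mul ℝ ℝ, volume] Δ J) x := by
  have hsm : ContDiff ℝ ∞ (f ⋆[mul ℝ ℝ, volume] J) :=
    hJs.contDiff_convolution_right (mul ℝ ℝ) hf hJ
  have hd {g : E → ℝ} (hg : ContDiff ℝ ∞ g) (y v : E) :
      iteratedFDeriv ℝ 2 g y ![v, v] = fderiv ℝ (fun z => fderiv ℝ g z v) y v := by
    rw [iteratedFDeriv_two_apply, fderiv_clm_apply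
      ((hg.fderiv_right (m := ∞) (by simp)).differentiable (by simp) y) (differentiableAt_const v)]
    simp
  have hdir (v : E) : ContDiff ℝ ∞ fun a => fderiv ℝ J a v :=
    (hJ.fderiv_right (m := ∞) (by simp)).clm_apply contDiff_const
  have hdirs (v : E) : HasCompactSupport fun a => fderiv ℝ J a v := hJs.fderiv_apply ℝ v
  set b := stdOrthonormalBasis ℝ E
  have hterm (v : E) : iteratedFDeriv ℝ 2 (f ⋆[mul ℝ ℝ, volume] J) x ![v, v] =
      (f ⋆[mul ℝ ℝ, volume] fun a => iteratedFDeriv ℝ 2 J a ![v, v]) x := by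
    rw [hd hsm, funext fun z => fderiv_convolution_mul_apply hf hJs (hJ.of_le (by simp)) z v,
      fderiv_convolution_mul_apply hf (hdirs v) ((hdir v).of_le (by simp))]
    simp only [hd hJ]
  rw [InnerProductSpace.laplacian_eq_iteratedFDeriv_orthonormalBasis _ b,
    InnerProductSpace.laplacian_eq_iteratedFDeriv_orthonormalBasis _ b]
  simp only [hterm, convolution_def, mul_apply', Finset.mul_sum]
  rw [integral_finsetSum]
  intro i _
  have hc : Continuous fun a => iteratedFDeriv ℝ 2 J a ![b i, b i] := by
    simp only [hd hJ]
    exact ((hdir (b i)).fderiv_right (m := ∞) (by simp)).continuous.clm_apply continuous_const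
  have hs : HasCompactSupport fun a => iteratedFDeriv ℝ 2 J a ![b i, b i] := by
    simp only [hd hJ]
    exact (hdirs (b i)).fderiv_apply ℝ (b i)
  exact hs.convolutionExists_right (mul ℝ ℝ) hf hc x

/-- Fubini applies because `K` is integrable and `|J| * |ψ|` is bounded. -/
lemma convolution_mul_assoc_of_bounded {K J ψ : E → ℝ} (hK : Integrable K)
    (hKc : Continuous K) (hJ : Continuous J) (hJs : HasCompactSupport J)
    (hψ : AEStronglyMeasurable ψ) {B : ℝ} (hB : ∀ x, |ψ x| ≤ B) (x : E) :
    ((K ⋆[mul ℝ ℝ, volume] J) ⋆[mul ℝ ℝ, volume] ψ) x =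
      (K ⋆[mul ℝ ℝ, volume] (J ⋆[mul ℝ ℝ, volume] ψ)) x := by
  have hJi := hJ.integrable_of_hasCompactSupport hJs (μ := volume)
  have hψn : LocallyIntegrable fun x => ‖ψ x‖ := by
    refine (locallyIntegrable_const B).mono hψ.norm (.of_forall fun y => ?_)
    rw [norm_norm]
    exact (hB y).trans (le_abs_self B)
  have hJψ : Continuous ((fun x => ‖J x‖) ⋆[mul ℝ ℝ, volume] fun x => ‖ψ x‖) :=
    hJs.norm.continuous_convolution_left (mul ℝ ℝ) hJ.norm hψn
  refine convolution_assoc (mul ℝ ℝ) (mul ℝ ℝ) (mul ℝ ℝ) (mul ℝ ℝ) (fun a b c => mul_assoc a b c)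
    hKc.aestronglyMeasurable hJ.aestronglyMeasurable hψ
    (.of_forall (hJs.convolutionExists_right (mul ℝ ℝ) hKc.locallyIntegrable hJ))
    (.of_forall (hJs.norm.convolutionExists_left (mul ℝ ℝ) hJ.norm hψn)) ?_
  refine convolutionExists_mul_of_bounded hK.norm hJψ.aestronglyMeasurable
    (B := ∫ t, ‖J t‖ * B) (fun y => ?_) x
  rw [convolution_def, ← Real.norm_eq_abs]
  refine norm_integral_le_of_norm_le (hJi.norm.mul_const B) (.of_forall fun t => ?_)
  simp only [mul_apply', norm_mul, norm_norm]
  exact mul_le_mul_of_nonneg_left (hB _) (norm_nonneg _)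

/-- Convolving a Schwartz function with a bounded function of bounded support gives a function
that decays faster than any power. -/
lemma SchwartzMap.exists_norm_pow_mul_convolution_le (K : 𝓢(E, ℝ)) {f : E → ℝ} {B R : ℝ}
    (hB : ∀ x, |f x| ≤ B) (hR0 : 0 ≤ R) (hR : ∀ x, f x ≠ 0 → ‖x‖ ≤ R) (n : ℕ) :
    ∃ C, ∀ x, ‖x‖ ^ n * |(K ⋆[mul ℝ ℝ, volume] f) x| ≤ C := by
  have hB0 : 0 ≤ B := (abs_nonneg _).trans (hB 0)
  -- Where `f (x - t) ≠ 0`, `‖x‖ ≤ ‖t‖ + R`; convexity of the `n`-th power splits the sum, and the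
  -- moments of `K` are finite.
  refine ⟨∫ t, 2 ^ (n - 1) * B * (‖t‖ ^ n * ‖K t‖ + R ^ n * ‖K t‖), fun x => ?_⟩
  rw [convolution_def, ← abs_of_nonneg (pow_nonneg (norm_nonneg x) n), ← abs_mul,
    ← integral_const_mul, ← Real.norm_eq_abs]
  refine norm_integral_le_of_norm_le (((K.integrable_pow_mul volume n).add
    (K.integrable.norm.const_mul _)).const_mul _) (.of_forall fun t => ?_)
  by_cases h : f (x - t) = 0
  · rw [h, map_zero, mul_zero, norm_zero]
    positivity
  · have h1 : ‖x‖ ≤ ‖t‖ + ‖x - t‖ := by simpa using norm_add_le t (x - t)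
    have h2 := hR _ h
    have h3 : ‖x‖ ^ n ≤ 2 ^ (n - 1) * (‖t‖ ^ n + R ^ n) :=
      (pow_le_pow_left₀ (norm_nonneg _) (h1.trans (by gcongr)) n).trans
        (add_pow_le (norm_nonneg _) ((norm_nonneg _).trans h2) n)
    simp only [mul_apply', norm_mul, norm_pow, norm_norm]
    calc ‖x‖ ^ n * (‖K t‖ * ‖f (x - t)‖) ≤ (2 ^ (n - 1) * (‖t‖ ^ n + R ^ n)) * (‖K t‖ * B) := by
          refine mul_le_mul h3 (mul_le_mul_of_nonneg_left (hB _) (norm_nonneg _)) (by positivity) ?_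
          exact (by positivity : (0:ℝ) ≤ ‖x‖ ^ n).trans h3
      _ = _ := by ring

end Convolution

/-! ### Unique differentiability up to the boundary. -/

section UniqueDiff

/-- The tangent cone contains the open half-space where the differential of `ρ` is positive, and a
nonempty open half-space spans. -/
lemma uniqueDiffWithinAt_of_fderiv_ne_zero {E : Type*} [NormedAddCommGroup E] [NormedSpace ℝ E]
    {s U : Set E} {ρ : E → ℝ} {p : E} (hU : U ∈ 𝓝 p) (hρ : DifferentiableAt ℝ ρ p)
    (hρ' : fderiv ℝ ρ p ≠ 0) (hps : p ∈ s) (hs : ∀ x ∈ U, ρ p ≤ ρ x → x ∈ s) :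
    UniqueDiffWithinAt ℝ s p := by
  have hcone (v : E) (hv : 0 < fderiv ℝ ρ p v) : v ∈ tangentConeAt ℝ s p := by
    have hcurve : HasDerivAt (fun t : ℝ => p + t • v) v 0 := by
      simpa using ((hasDerivAt_id (0 : ℝ)).smul_const v).const_add p
    have hd : HasDerivAt (fun t : ℝ => ρ (p + t • v)) (fderiv ℝ ρ p v) 0 := by
      have h0 : HasFDerivAt ρ (fderiv ℝ ρ p) (p + (0 : ℝ) • v) := by simpa using hρ.hasFDerivAt
      exact h0.comp_hasDerivAt (0 : ℝ) hcurve
    have hslope := (hasDerivAt_iff_tendsto_slope.1 hd).mono_left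
      (nhdsWithin_mono 0 (fun t (ht : t ∈ Set.Ioi (0 : ℝ)) => (ne_of_gt ht : t ∈ ({0}ᶜ : Set ℝ))))
    have hmem : ∀ᶠ t : ℝ in 𝓝[>] 0, p + t • v ∈ U :=
      (hcurve.continuousAt.eventually (by simpa using hU)).filter_mono nhdsWithin_le_nhds
    refine mem_tangentConeAt_of_add_smul_mem (l := 𝓝[>] (0 : ℝ)) (c := id) ?_ ?_
    · exact tendsto_id.mono_left (nhdsWithin_mono 0 fun t (ht : 0 < t) => ht.ne')
    · filter_upwards [hmem, hslope.eventually (lt_mem_nhds hv), self_mem_nhdsWithin] with t ht1 ht2 ht3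
      have ht3 : 0 < t := ht3
      refine hs _ ht1 ?_
      rw [slope_def_field, sub_zero, lt_div_iff₀ ht3, zero_mul, zero_smul, add_zero] at ht2
      exact (sub_pos.1 ht2).le
  obtain ⟨w, hw⟩ : ∃ w, fderiv ℝ ρ p w ≠ 0 := by
    by_contra! h
    exact hρ' (ContinuousLinearMap.ext h)
  set v₀ := (fderiv ℝ ρ p w)⁻¹ • w with hv₀
  have hv1 : fderiv ℝ ρ p v₀ = 1 := by simp [hv₀, hw]
  refine ⟨?_, subset_closure hps⟩
  have htop : Submodule.span ℝ (tangentConeAt ℝ s p) = ⊤ := by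
    refine eq_top_iff.2 fun x _ => ?_
    -- Large enough to push `x + c • v₀` into the half-space, so `x` is a difference of elements of
    -- the span.
    set c := |fderiv ℝ ρ p x| + 1
    have h1 := Submodule.subset_span (R := ℝ) (hcone (x + c • v₀) (by
      rw [map_add, map_smul, hv1, smul_eq_mul, mul_one]
      linarith [neg_abs_le (fderiv ℝ ρ p x)]))
    have h2 := Submodule.smul_mem _ c
      (Submodule.subset_span (R := ℝ) (hcone v₀ (by rw [hv1]; exact one_pos)))
    simpa using Submodule.sub_mem _ h1 h2
  rw [htop]
  exact dense_univ

lemma HasSmoothBoundary.uniqueDiffOn_compl {N : ℕ} {H : Set (EuclideanSpace ℝ (Fin N))}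
    (hH : HasSmoothBoundary H) (hopen : IsOpen H) : UniqueDiffOn ℝ Hᶜ := by
  intro p hp
  by_cases hfr : p ∈ frontier H
  · obtain ⟨U, ρ, hU, hpU, hρ, hρ', hHU⟩ := hH p hfr
    have hmem : ∀ x ∈ U, x ∈ H ↔ ρ x < 0 := fun x hx => by
      have := Set.ext_iff.1 hHU x
      simpa [hx] using this
    refine uniqueDiffWithinAt_of_fderiv_ne_zero (hU.mem_nhds hpU)
      ((hρ.contDiffAt (hU.mem_nhds hpU)).differentiableAt (by simp)) hρ' hp fun x hx hle => ?_
    have h0 : 0 ≤ ρ p := not_lt.1 fun h => hp ((hmem p hpU).2 h)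
    exact fun hxH => absurd ((hmem x hx).1 hxH) (not_lt.2 (h0.trans hle))
  · refine uniqueDiffWithinAt_of_mem_nhds ?_
    rw [frontier, hopen.interior_eq] at hfr
    have : p ∉ closure H := fun h => hfr ⟨h, hp⟩
    exact mem_of_superset (isClosed_closure.isOpen_compl.mem_nhds this)
      (Set.compl_subset_compl.2 subset_closure)

end UniqueDiff

/-! ### The stationary solution. -/

section Stationary

open ContinuousLinearMap Laplacian

variable {N : ℕ} {J : EuclideanSpace ℝ (Fin N) → ℝ} {H : Set (EuclideanSpace ℝ (Fin N))}
  {φ ψ : EuclideanSpace ℝ (Fin N) → ℝ}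

lemma IsDiffusionKernel.hasCompactSupport (hJ : IsDiffusionKernel J) : HasCompactSupport J :=
  .of_isClosed_subset (isCompact_closedBall 0 1) (isClosed_tsupport J) hJ.support_subset

lemma IsDiffusionKernel.integrable (hJ : IsDiffusionKernel J) : Integrable J :=
  hJ.smooth.continuous.integrable_of_hasCompactSupport hJ.hasCompactSupport

lemma IsStationarySolution.locallyIntegrable_one_sub (hφ : IsStationarySolution J H φ)
    (hψ : ∀ x, ψ x = 1 - φ x) : LocallyIntegrable ψ := by
  rw [funext hψ]
  exact (locallyIntegrable_const 1).sub hφ.locallyIntegrable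

lemma IsStationarySolution.convolution_one_sub_eq (hJ : IsDiffusionKernel J)
    (hφ : IsStationarySolution J H φ) (hψ : ∀ x, ψ x = 1 - φ x) {x : EuclideanSpace ℝ (Fin N)}
    (hx : x ∈ Hᶜ) : (J ⋆[mul ℝ ℝ, volume] ψ) x = ψ x := by
  rw [hψ x, ← hφ.conv_eq x hx, ← hJ.integral_eq_one, convolution_def, convolution_def,
    ← integral_sub hJ.integrable
      (hJ.hasCompactSupport.convolutionExists_left (mul ℝ ℝ) hJ.smooth.continuous
        hφ.locallyIntegrable x)]
  refine integral_congr_ae (.of_forall fun t => ?_)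
  simp only [mul_apply', hψ]
  ring

/-- Off a compact set `ψ` is small; on it, `ψ` is `1` in `H` and elsewhere equals `J * ψ`,
continuous by mere local integrability of `ψ`. -/
lemma IsStationarySolution.exists_abs_one_sub_le (hJ : IsDiffusionKernel J)
    (hφ : IsStationarySolution J H φ) (hψ : ∀ x, ψ x = 1 - φ x) : ∃ B, ∀ x, |ψ x| ≤ B := by
  have hlim : Tendsto ψ (cocompact (EuclideanSpace ℝ (Fin N))) (𝓝 0) := by
    rw [funext hψ]
    simpa using (tendsto_const_nhds (x := (1 : ℝ))).sub hφ.tendsto_one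
  have hlim' : Tendsto (fun x => |ψ x|) (cocompact (EuclideanSpace ℝ (Fin N))) (𝓝 0) := by
    simpa using hlim.abs
  obtain ⟨S, hS, hSs⟩ := mem_cocompact.1 (hlim'.eventually (gt_mem_nhds one_pos))
  have hu : Continuous (J ⋆[mul ℝ ℝ, volume] ψ) :=
    hJ.hasCompactSupport.continuous_convolution_left (mul ℝ ℝ) hJ.smooth.continuous
      (hφ.locallyIntegrable_one_sub hψ)
  obtain ⟨B, hB⟩ := hS.exists_bound_of_continuousOn hu.continuousOn
  refine ⟨max 1 B, fun x => ?_⟩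
  by_cases hxS : x ∈ S
  · by_cases hxH : x ∈ H
    · simp [hψ, hφ.eq_zero x hxH]
    · rw [← hφ.convolution_one_sub_eq hJ hψ hxH]
      exact (hB x hxS).trans (le_max_right _ _)
  · exact (le_of_lt (hSs hxS)).trans (le_max_left _ _)

/-- The Laplacian of the smooth extension `J * ψ` of `ψ` from the exterior domain decays faster
than any power. -/
lemma IsStationarySolution.exists_norm_pow_mul_laplacian_le [NeZero N] (hJ : IsDiffusionKernel J)
    (hφ : IsStationarySolution J H φ) (hψ : ∀ x, ψ x = 1 - φ x) (hH : Bornology.IsBounded H)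
    (n : ℕ) : ∃ C, ∀ x, ‖x‖ ^ n * |Δ (J ⋆[mul ℝ ℝ, volume] ψ) x| ≤ C := by
  obtain ⟨K, hK⟩ := exists_schwartz_kernel hJ.smooth hJ.nonneg hJ.pos_zero hJ.radial
    hJ.support_subset hJ.integral_eq_one
  obtain ⟨B, hB⟩ := hφ.exists_abs_one_sub_le hJ hψ
  obtain ⟨R, hR0, hR⟩ := hH.exists_pos_norm_le
  have hψl := hφ.locallyIntegrable_one_sub hψ
  have hψm := hψl.aestronglyMeasurable
  set u := J ⋆[mul ℝ ℝ, volume] ψ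
  have hu : Continuous u :=
    hJ.hasCompactSupport.continuous_convolution_left (mul ℝ ℝ) hJ.smooth.continuous hψl
  have huB (x) : |u x| ≤ ∫ t, ‖J t‖ * B := by
    rw [← Real.norm_eq_abs]
    refine norm_integral_le_of_norm_le (hJ.integrable.norm.mul_const B) (.of_forall fun t => ?_)
    rw [mul_apply', norm_mul]
    exact mul_le_mul_of_nonneg_left (hB _) (norm_nonneg _)
  obtain ⟨C, hC⟩ := K.exists_norm_pow_mul_convolution_le (f := ψ - u)
    (B := B + ∫ t, ‖J t‖ * B) (R := R) (fun x => (abs_sub _ _).trans (add_le_add (hB x) (huB x)))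
    hR0.le (fun x hx => hR x (by
      by_contra hxH
      exact hx (sub_eq_zero.2 (hφ.convolution_one_sub_eq hJ hψ hxH).symm))) n
  refine ⟨C, fun x => ?_⟩
  have hJK : Continuous (K ⋆[mul ℝ ℝ, volume] J) :=
    hJ.hasCompactSupport.continuous_convolution_right (mul ℝ ℝ) K.continuous.locallyIntegrable
      hJ.smooth.continuous
  have hJKi : Integrable (K ⋆[mul ℝ ℝ, volume] J) :=
    K.integrable.integrable_convolution (mul ℝ ℝ) hJ.integrable
  have h1 : Δ u x = (Δ J ⋆[mul ℝ ℝ, volume] ψ) x := by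
    simp only [u]
    rw [convolution_mul_comm J ψ, laplacian_convolution_mul hψl hJ.hasCompactSupport hJ.smooth,
      convolution_mul_comm]
  have h2 : (Δ J ⋆[mul ℝ ℝ, volume] ψ) x = (K ⋆[mul ℝ ℝ, volume] ψ) x -
      ((K ⋆[mul ℝ ℝ, volume] J) ⋆[mul ℝ ℝ, volume] ψ) x := by
    have hi1 := convolutionExists_mul_of_bounded K.integrable hψm hB x
    have hi2 := convolutionExists_mul_of_bounded hJKi hψm hB x
    rw [convolution_def, convolution_def, convolution_def (f := K ⋆[mul ℝ ℝ, volume] J),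
      ← integral_sub hi1 hi2]
    refine integral_congr_ae (.of_forall fun t => ?_)
    simp only [mul_apply']
    rw [← hK t, convolution_mul_comm J K, sub_mul]
  have h3 : (K ⋆[mul ℝ ℝ, volume] (ψ - u)) x =
      (K ⋆[mul ℝ ℝ, volume] ψ) x - (K ⋆[mul ℝ ℝ, volume] u) x := by
    have hi1 := convolutionExists_mul_of_bounded K.integrable hψm hB x
    have hi2 := convolutionExists_mul_of_bounded K.integrable hu.aestronglyMeasurable huB x
    rw [convolution_def, convolution_def, convolution_def, ← integral_sub hi1 hi2]
    refine integral_congr_ae (.of_forall fun t => ?_)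
    simp only [Pi.sub_apply, map_sub]
  -- Associativity turns `(K * J) * ψ` into `K * u`, whence `Δ u = K * (ψ - u)`.
  rw [h1, h2, convolution_mul_assoc_of_bounded K.integrable K.continuous hJ.smooth.continuous
    hJ.hasCompactSupport hψm hB x, ← h3]
  exact hC x

end Stationary

/-! ### Transfer from `u` to `ψ` on the exterior domain. -/

theorem mainTheorem11 (N : ℕ) (hN : 3 ≤ N)
    (J : EuclideanSpace ℝ (Fin N) → ℝ) (hJ : IsDiffusionKernel J)
    (H : Set (EuclideanSpace ℝ (Fin N))) (hHopen : IsOpen H) (hHbdd : Bornology.IsBounded H)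
    (hHsmooth : HasSmoothBoundary H) (hH0 : (0 : EuclideanSpace ℝ (Fin N)) ∈ H)
    (φ ψ : EuclideanSpace ℝ (Fin N) → ℝ) (hφ : IsStationarySolution J H φ)
    (hψ : ∀ x, ψ x = 1 - φ x) :
    ContDiffOn ℝ ∞ ψ Hᶜ ∧
    (∃ C : ℝ, ∀ x ∈ Hᶜ, |InnerProductSpace.laplacianWithin ψ Hᶜ x| ≤ C / ‖x‖ ^ (N + 2)) ∧
    IntegrableOn (InnerProductSpace.laplacianWithin ψ Hᶜ) Hᶜ volume := by
  have : NeZero N := ⟨by omega⟩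
  set u := J ⋆[ContinuousLinearMap.mul ℝ ℝ, volume] ψ with hu
  have hsm : ContDiff ℝ ∞ u :=
    hJ.hasCompactSupport.contDiff_convolution_left _ hJ.smooth (hφ.locallyIntegrable_one_sub hψ)
  have heq : Set.EqOn ψ u Hᶜ := fun x hx => (hφ.convolution_one_sub_eq hJ hψ hx).symm
  have huniq := hHsmooth.uniqueDiffOn_compl hHopen
  have hlap : Set.EqOn (InnerProductSpace.laplacianWithin ψ Hᶜ) (Laplacian.laplacian u) Hᶜ := by
    intro x hx
    rw [InnerProductSpace.laplacianWithin_eq_iteratedFDerivWithin_stdOrthonormalBasis _ huniq hx,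
      InnerProductSpace.laplacian_eq_iteratedFDeriv_stdOrthonormalBasis]
    have hu2 : ContDiff ℝ 2 u := contDiff_infty.1 hsm 2
    rw [iteratedFDerivWithin_congr heq hx,
      iteratedFDerivWithin_eq_iteratedFDeriv huniq hu2.contDiffAt hx]
  have hcont : Continuous (Laplacian.laplacian u) := by
    rw [InnerProductSpace.laplacian_eq_iteratedFDeriv_stdOrthonormalBasis]
    refine continuous_finsetSum _ fun i _ => ?_
    have hu2 : ContDiff ℝ 2 u := contDiff_infty.1 hsm 2
    exact (ContinuousMultilinearMap.apply ℝ (fun _ : Fin 2 => EuclideanSpace ℝ (Fin N)) ℝ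
      _).continuous.comp (hu2.continuous_iteratedFDeriv (m := 2) le_rfl)
  refine ⟨hsm.contDiffOn.congr heq, ?_, ?_⟩
  · obtain ⟨C, hC⟩ := hφ.exists_norm_pow_mul_laplacian_le hJ hψ hHbdd (N + 2)
    refine ⟨C, fun x hx => ?_⟩
    have hx0 : 0 < ‖x‖ := norm_pos_iff.2 fun h => hx (h ▸ hH0)
    rw [hlap hx, le_div_iff₀ (by positivity), mul_comm]
    exact hC x
  -- Exponent `0` gives boundedness; exponent `integrablePower` gives integrable decay at infinity.
  · obtain ⟨C₀, hC₀⟩ := hφ.exists_norm_pow_mul_laplacian_le hJ hψ hHbdd 0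
    obtain ⟨C₁, hC₁⟩ := hφ.exists_norm_pow_mul_laplacian_le hJ hψ hHbdd
      (volume : Measure (EuclideanSpace ℝ (Fin N))).integrablePower
    have hint : Integrable fun x => ‖x‖ ^ 0 * ‖Laplacian.laplacian u x‖ :=
      integrable_of_le_of_pow_mul_le (fun x => by simpa using hC₀ x) (fun x => by simpa using hC₁ x)
        hcont.aestronglyMeasurable
    refine IntegrableOn.congr_fun ?_ hlap.symm hHopen.measurableSet.compl
    refine ((integrable_norm_iff hcont.aestronglyMeasurable).1 ?_).integrableOn
    simpa only [pow_zero, one_mul] using hint
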